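/- All point sets are finite subsets of $\mathbb{R}^2$ in general position, meaning that no three of their points are collinear. A \emph{triangulation} of a point set $A$ is a maximal set of line segments between points of $A$ such that any two different segments intersect in a common endpoint or not at all. A \emph{triangle} of a triangulation is a triple of points of $A$ that are pairwise joined by segments of the triangulation and whose convex hull contains no other point of $A$. Triangulations $\mathcal{T}_A$ of $A$ and $\mathcal{T}_B$ of $B$ are \emph{compatible} if there is a bijection $f : A \to B$ such that $\triangle(a,b,c)$ is a clockwise-oriented triangle of $\mathcal{T}_A$ if and only if $\triangle(f(a),f(b),f(c))$ is a clockwise-oriented triangle of $\mathcal{T}_B$. \textbf{Theorem ($d$-way compatible triangulation).} Let $S_1,\dots,S_d \subset \mathbb{R}^2$ be point sets in general position with $|S_i| = n$ for every $i$. Then there are finite sets of points (Steiner points) $P_1,\dots,P_d \subset \mathbb{R}^2$ with $P_i \cap S_i = \emptyset$ and $|P_i| \le \frac{n}{2}+3$ for every $i$ (a bound independent of $d$), such that each $S_i \cup P_i$ is in general position, and there are triangulations $\mathcal{T}_i$ of $S_i \cup P_i$ such that $\mathcal{T}_i$ and $\mathcal{T}_j$ are compatible for all $i, j$. -/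

import Mathlib

/-- The Euclidean plane. -/
abbrev Plane : Type := EuclideanSpace ℝ (Fin 2)

/-- A point set is in general position if no three of its points are collinear. -/
def InGeneralPosition (A : Set Plane) : Prop :=
  ∀ a ∈ A, ∀ b ∈ A, ∀ c ∈ A, a ≠ b → a ≠ c → b ≠ c → ¬ Collinear ℝ ({a, b, c} : Set Plane)

/-- A set of line segments between points of `A` (recorded as a graph on `A`, an edge `ab` standing
for the segment from `a` to `b`) is noncrossing if any two different segments
meet in a common endpoint or not at all. -/
def IsNoncrossing {A : Set Plane} (G : SimpleGraph A) : Prop :=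
  ∀ a b c d : A, G.Adj a b → G.Adj c d → s(a, b) ≠ s(c, d) →
    segment ℝ (a : Plane) b ∩ segment ℝ (c : Plane) d ⊆
      ({(a : Plane), (b : Plane)} : Set Plane) ∩ {(c : Plane), (d : Plane)}

/-- A triangulation of `A` is a maximal noncrossing set of segments between points of `A`. -/
def IsTriangulation {A : Set Plane} (G : SimpleGraph A) : Prop :=
  Maximal IsNoncrossing G

/-- The triple `a, b, c` is traversed clockwise: the determinant of `b - a` and `c - a`
is negative. -/
def Clockwise (a b c : Plane) : Prop :=
  (b 0 - a 0) * (c 1 - a 1) - (b 1 - a 1) * (c 0 - a 0) < 0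

/-- `a, b, c` is a clockwise-oriented triangle of the triangulation `G` of `A`: its three sides are
segments of `G`, it contains no other point of `A`, and it is traversed clockwise. -/
def IsClockwiseTriangle {A : Set Plane} (G : SimpleGraph A) (a b c : A) : Prop :=
  G.Adj a b ∧ G.Adj b c ∧ G.Adj a c ∧
    (∀ p ∈ A, p ∈ convexHull ℝ ({(a : Plane), (b : Plane), (c : Plane)} : Set Plane) →
      p = a ∨ p = b ∨ p = c) ∧
    Clockwise a b c

/-- Two triangulations are compatible if some bijection of their point sets carries the
clockwise-oriented triangles of the one exactly to those of the other. -/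
def AreCompatible {A B : Set Plane} (G : SimpleGraph A) (H : SimpleGraph B) : Prop :=
  ∃ f : A ≃ B, ∀ a b c : A,
    IsClockwiseTriangle G a b c ↔ IsClockwiseTriangle H (f a) (f b) (f c)

/-! Two Steiner points per set suffice: they make every set of n points carry the same abstract
triangulation. Sort the points along a linear functional that is injective on the set, and put two
apices on a level line below all its values, far out in opposite directions. Both apices then see
the points in sorted order, from opposite sides. Join consecutive points into a path, join both
apices to every point and to each other: this is the double fan.

`IsFanPlacement` isolates the area signs that such a drawing satisfies, and the rest follows from
these signs alone. Spokes and path edges do not cross (`segmentsCompatible_of_adj`). Any further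
chord skips a path point and crosses a spoke at it (`exists_spoke_crossing`), so the drawing is
maximal. The clockwise triangles are described by indices only (`isClockwiseTriangle_apex_iff`,
`isClockwiseTriangle_spoke_iff`), so matching equal labels makes any two drawings compatible, for
any number of sets. -/

open Filter

/-! ### Signed areas -/

/-- Twice the signed area of the triangle `a, b, c`, positive when it is traversed
counterclockwise. -/
def signedArea (a b c : Plane) : ℝ :=
  (b 0 - a 0) * (c 1 - a 1) - (b 1 - a 1) * (c 0 - a 0)

theorem signedArea_rotate (a b c : Plane) : signedArea b c a = signedArea a b c := by
  simp only [signedArea]; ring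

theorem signedArea_swap (a b c : Plane) : signedArea a c b = -signedArea a b c := by
  simp only [signedArea]; ring

@[simp] theorem signedArea_left (a b : Plane) : signedArea a b a = 0 := by
  simp only [signedArea]; ring

@[simp] theorem signedArea_right (a b : Plane) : signedArea a b b = 0 := by
  simp only [signedArea]; ring

theorem signedArea_combo (a b c d : Plane) {s t : ℝ} (h : s + t = 1) :
    signedArea a b (s • c + t • d) = s * signedArea a b c + t * signedArea a b d := by
  obtain rfl : t = 1 - s := by linarith
  simp only [signedArea, PiLp.add_apply, PiLp.smul_apply, smul_eq_mul]; ring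

theorem collinear_iff_signedArea_eq_zero (a b c : Plane) :
    Collinear ℝ ({a, b, c} : Set Plane) ↔ signedArea a b c = 0 := by
  rw [collinear_iff_of_mem (p₀ := a) (by simp)]
  constructor
  · rintro ⟨v, hv⟩
    obtain ⟨r, rfl⟩ := hv b (by simp)
    obtain ⟨s, rfl⟩ := hv c (by simp)
    simp only [signedArea, vadd_eq_add, PiLp.add_apply, PiLp.smul_apply, smul_eq_mul]; ring
  · intro h
    simp only [signedArea] at h
    by_cases hab : b = a
    · refine ⟨c - a, ?_⟩
      simp only [Set.mem_insert_iff, Set.mem_singleton_iff, forall_eq_or_imp, forall_eq]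
      exact ⟨⟨0, by simp⟩, ⟨0, by simp [hab]⟩, ⟨1, by simp⟩⟩
    · have key : ∃ r : ℝ, c = r • (b - a) + a := by
        by_cases h0 : b 0 - a 0 = 0
        · have h1 : b 1 - a 1 ≠ 0 := by
            intro h1
            apply hab
            ext i; fin_cases i
            · exact sub_eq_zero.1 h0
            · exact sub_eq_zero.1 h1
          refine ⟨(c 1 - a 1) / (b 1 - a 1), ?_⟩
          ext i; fin_cases i
          · simp only [Fin.zero_eta, PiLp.add_apply, PiLp.smul_apply, PiLp.sub_apply,
              smul_eq_mul, h0]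
            have : (b 1 - a 1) * (c 0 - a 0) = 0 := by rw [h0] at h; linarith
            have := (mul_eq_zero.1 this).resolve_left h1
            linarith
          · simp only [Fin.mk_one, PiLp.add_apply, PiLp.smul_apply, PiLp.sub_apply, smul_eq_mul]
            field_simp; ring
        · refine ⟨(c 0 - a 0) / (b 0 - a 0), ?_⟩
          ext i; fin_cases i
          · simp only [Fin.zero_eta, PiLp.add_apply, PiLp.smul_apply, PiLp.sub_apply, smul_eq_mul]
            field_simp; ring
          · simp only [Fin.mk_one, PiLp.add_apply, PiLp.smul_apply, PiLp.sub_apply, smul_eq_mul]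
            field_simp; linarith
      obtain ⟨r, hr⟩ := key
      refine ⟨b - a, ?_⟩
      simp only [Set.mem_insert_iff, Set.mem_singleton_iff, forall_eq_or_imp, forall_eq]
      exact ⟨⟨0, by simp⟩, ⟨1, by simp⟩, ⟨r, by simpa using hr⟩⟩

/-- The area is affine along the segment, so it can fail to be positive only at the end `c`. The
factor `k` lets one lemma serve both sides of a line. -/
theorem eq_of_mem_segment_of_nonpos {a b c d x : Plane} {k : ℝ} (hx : x ∈ segment ℝ c d)
    (hc : 0 ≤ k * signedArea a b c) (hd : 0 < k * signedArea a b d)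
    (hle : k * signedArea a b x ≤ 0) : x = c := by
  obtain ⟨s, t, hs, ht, hst, rfl⟩ := hx
  rw [signedArea_combo a b c d hst] at hle
  have h1 : 0 ≤ s * (k * signedArea a b c) := mul_nonneg hs hc
  have h2 : t = 0 := by
    by_contra h
    have : 0 < t * (k * signedArea a b d) := mul_pos (lt_of_le_of_ne ht (Ne.symm h)) hd
    nlinarith
  obtain rfl : s = 1 := by linarith
  simp [h2]

theorem signedArea_eq_zero_of_mem_segment {a b x : Plane} (hx : x ∈ segment ℝ a b) :
    signedArea a b x = 0 := by
  obtain ⟨s, t, hs, ht, hst, rfl⟩ := hx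
  simp [signedArea_combo a b a b hst]

theorem nonneg_of_mem_segment {a b c d x : Plane} {k : ℝ} (hx : x ∈ segment ℝ c d)
    (hc : 0 ≤ k * signedArea a b c) (hd : 0 ≤ k * signedArea a b d) :
    0 ≤ k * signedArea a b x := by
  obtain ⟨s, t, hs, ht, hst, rfl⟩ := hx
  rw [signedArea_combo a b c d hst]
  nlinarith [mul_nonneg hs hc, mul_nonneg ht hd]

theorem nonneg_of_mem_convexHull {a b x : Plane} {k : ℝ} {s : Set Plane}
    (hx : x ∈ convexHull ℝ s) (hs : ∀ y ∈ s, 0 ≤ k * signedArea a b y) :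
    0 ≤ k * signedArea a b x := by
  have hconv : Convex ℝ {y | 0 ≤ k * signedArea a b y} :=
    convex_iff_segment_subset.2 fun c hc d hd y hy => nonneg_of_mem_segment hy hc hd
  exact convexHull_min hs hconv hx

/-- The barycentric coordinates of `x` are the ratios of the three subtriangle areas to the whole
area. -/
theorem mem_convexHull_of_signedArea {a b c x : Plane} {k : ℝ} (h : 0 < k * signedArea a b c)
    (h1 : 0 ≤ k * signedArea a b x) (h2 : 0 ≤ k * signedArea b c x)
    (h3 : 0 ≤ k * signedArea c a x) : x ∈ convexHull ℝ ({a, b, c} : Set Plane) := by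
  have hne : k * signedArea a b c ≠ 0 := h.ne'
  have hconv := convex_convexHull ℝ ({a, b, c} : Set Plane)
  have hsum : k * signedArea b c x + k * signedArea c a x + k * signedArea a b x
      = k * signedArea a b c := by simp only [signedArea]; ring
  have hmem := hconv.sum_mem (t := Finset.univ)
    (w := ![k * signedArea b c x / (k * signedArea a b c),
      k * signedArea c a x / (k * signedArea a b c),
      k * signedArea a b x / (k * signedArea a b c)]) (z := ![a, b, c])
    (by
      intro i _
      fin_cases i
      · exact div_nonneg h2 h.le
      · exact div_nonneg h3 h.le
      · exact div_nonneg h1 h.le)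
    (by
      simp only [Fin.sum_univ_three, Matrix.cons_val]
      rw [← add_div, ← add_div, hsum, div_self hne])
    (by
      intro i _
      apply subset_convexHull
      fin_cases i <;> simp)
  convert hmem using 1
  simp only [Fin.sum_univ_three, Matrix.cons_val]
  ext i
  simp only [PiLp.add_apply, PiLp.smul_apply, smul_eq_mul]
  obtain ⟨hk, hA⟩ := mul_ne_zero_iff.1 hne
  field_simp
  fin_cases i <;> simp only [signedArea, Fin.zero_eta, Fin.mk_one] <;> ring

/-- Each segment has its ends strictly on opposite sides of the other's line; dividing each in the
ratio of these areas gives the same point. -/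
theorem exists_mem_segment_inter {a b c d : Plane} (h1 : 0 < signedArea a b c * -signedArea a b d)
    (h2 : 0 < signedArea c d a * -signedArea c d b) :
    (segment ℝ a b ∩ segment ℝ c d).Nonempty := by
  have hD : signedArea c d a - signedArea c d b = signedArea a b d - signedArea a b c := by
    simp only [signedArea]; ring
  have aux : ∀ p q : ℝ, 0 < p * -q →
      p - q ≠ 0 ∧ 0 ≤ p / (p - q) ∧ 0 ≤ -q / (p - q) := by
    intro p q h
    rcases pos_and_pos_or_neg_and_neg_of_mul_pos h with ⟨hp, hq⟩ | ⟨hp, hq⟩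
    · have : 0 < p - q := by linarith
      exact ⟨this.ne', div_nonneg hp.le this.le, div_nonneg hq.le this.le⟩
    · have : p - q < 0 := by linarith
      exact ⟨this.ne, div_nonneg_of_nonpos hp.le this.le, div_nonneg_of_nonpos hq.le this.le⟩
  obtain ⟨n1, p1, q1⟩ := aux _ _ h1
  obtain ⟨n2, p2, q2⟩ := aux _ _ h2
  refine ⟨(-signedArea c d b / (signedArea c d a - signedArea c d b)) • a +
    (signedArea c d a / (signedArea c d a - signedArea c d b)) • b,
    ⟨_, _, q2, p2, ?_, rfl⟩, ⟨_, _, q1, p1, ?_, ?_⟩⟩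
  · rw [← add_div, neg_add_eq_sub, div_self n2]
  · rw [← add_div, neg_add_eq_sub, div_self n1]
  · ext i
    simp only [PiLp.add_apply, PiLp.smul_apply, smul_eq_mul]
    have n3 : signedArea a b d - signedArea a b c ≠ 0 := by rwa [← hD]
    rw [hD]
    field_simp
    fin_cases i <;> simp only [signedArea, Fin.zero_eta, Fin.mk_one] <;> ring

/-! ### The double fan over a path -/

/-- The path on `Fin n` together with two apices, adjacent to each other and to all of the path. -/
def doubleFan (n : ℕ) : SimpleGraph (Bool ⊕ Fin n) where
  Adj
    | .inl b, .inl c => b ≠ c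
    | .inl _, .inr _ => True
    | .inr _, .inl _ => True
    | .inr i, .inr j => (i : ℕ) + 1 = j ∨ (j : ℕ) + 1 = i
  symm := ⟨by
    rintro (b | i) (c | j) h
    · exact Ne.symm h
    · trivial
    · trivial
    · exact Or.symm h⟩
  loopless := ⟨by
    rintro (b | i) h
    · exact h rfl
    · rcases h with h | h <;> omega⟩

theorem doubleFan_adj_inl_inl {n : ℕ} {b c : Bool} :
    (doubleFan n).Adj (.inl b) (.inl c) ↔ b ≠ c := Iff.rfl

theorem doubleFan_adj_inl_inr {n : ℕ} (b : Bool) (i : Fin n) :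
    (doubleFan n).Adj (.inl b) (.inr i) := trivial

theorem doubleFan_adj_inr_inl {n : ℕ} (b : Bool) (i : Fin n) :
    (doubleFan n).Adj (.inr i) (.inl b) := trivial

theorem doubleFan_adj_inr_inr {n : ℕ} {i j : Fin n} :
    (doubleFan n).Adj (.inr i) (.inr j) ↔ (i : ℕ) + 1 = j ∨ (j : ℕ) + 1 = i := Iff.rfl

/-- Every edge is, up to its direction, of one of three kinds. -/
theorem doubleFan_adj_induction {n : ℕ} {p : Bool ⊕ Fin n → Bool ⊕ Fin n → Prop}
    (hsymm : ∀ a b, p a b → p b a) (hapex : p (.inl true) (.inl false))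
    (hspoke : ∀ b i, p (.inl b) (.inr i))
    (hpath : ∀ i j : Fin n, (i : ℕ) + 1 = j → p (.inr i) (.inr j))
    {a b : Bool ⊕ Fin n} (h : (doubleFan n).Adj a b) : p a b := by
  rcases a with b' | i <;> rcases b with c | j
  · cases b' <;> cases c
    · exact absurd rfl h
    · exact hsymm _ _ hapex
    · exact hapex
    · exact absurd rfl h
  · exact hspoke _ _
  · exact hsymm _ _ (hspoke _ _)
  · rcases h with h | h
    · exact hpath _ _ h
    · exact hsymm _ _ (hpath _ _ h)

/-- The sign with which an apex sees the path. -/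
def apexSign (b : Bool) : ℝ := if b then 1 else -1

/-- A drawing of the vertices of the double fan in which both apices see the path in order,
from opposite sides, and the line through the apices leaves the path on one side. -/
structure IsFanPlacement {n : ℕ} (φ : Bool ⊕ Fin n → Plane) : Prop where
  injective : Function.Injective φ
  spoke_pos : ∀ (b : Bool) (i j : Fin n), i < j →
    0 < apexSign b * signedArea (φ (.inl b)) (φ (.inr i)) (φ (.inr j))
  apex_pos : ∀ (b : Bool) (i : Fin n),
    0 < apexSign b * signedArea (φ (.inl b)) (φ (.inl !b)) (φ (.inr i))
  path_ne : ∀ i j k : Fin n, i ≠ j → i ≠ k → j ≠ k →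
    signedArea (φ (.inr i)) (φ (.inr j)) (φ (.inr k)) ≠ 0

/-! ### Sign rules and general position of a fan placement -/

namespace IsFanPlacement

variable {n : ℕ} {φ : Bool ⊕ Fin n → Plane}

theorem spoke_neg (h : IsFanPlacement φ) (b : Bool) {i j : Fin n} (hij : j < i) :
    apexSign b * signedArea (φ (.inl b)) (φ (.inr i)) (φ (.inr j)) < 0 := by
  rw [signedArea_swap]
  linarith [h.spoke_pos b j i hij]

theorem apex_neg (h : IsFanPlacement φ) (b : Bool) (i : Fin n) :
    apexSign b * signedArea (φ (.inl b)) (φ (.inr i)) (φ (.inl !b)) < 0 := by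
  rw [signedArea_swap]
  linarith [h.apex_pos b i]

theorem spoke_nonneg (h : IsFanPlacement φ) (b : Bool) {i j : Fin n} (hij : i ≤ j) :
    0 ≤ apexSign b * signedArea (φ (.inl b)) (φ (.inr i)) (φ (.inr j)) := by
  rcases hij.eq_or_lt with rfl | hij
  · simp
  · exact (h.spoke_pos b i j hij).le

theorem spoke_ne (h : IsFanPlacement φ) (b : Bool) {i j : Fin n} (hij : i ≠ j) :
    signedArea (φ (.inl b)) (φ (.inr i)) (φ (.inr j)) ≠ 0 := by
  intro h0
  rcases lt_or_gt_of_ne hij with hij | hij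
  · simpa [h0] using h.spoke_pos b i j hij
  · simpa [h0] using h.spoke_neg b hij

theorem apex_ne (h : IsFanPlacement φ) {b c : Bool} (hbc : b ≠ c) (i : Fin n) :
    signedArea (φ (.inl b)) (φ (.inl c)) (φ (.inr i)) ≠ 0 := by
  obtain rfl : c = !b := by cases b <;> cases c <;> simp_all
  intro h0
  simpa [h0] using h.apex_pos b i

theorem signedArea_ne (h : IsFanPlacement φ) {a b c : Bool ⊕ Fin n} (hab : a ≠ b) (hac : a ≠ c)
    (hbc : b ≠ c) : signedArea (φ a) (φ b) (φ c) ≠ 0 := by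
  rcases a with a | i <;> rcases b with b | j <;> rcases c with c | k <;>
    simp only [ne_eq, Sum.inl.injEq, Sum.inr.injEq, reduceCtorEq, not_false_eq_true] at hab hac hbc
  · cases a <;> cases b <;> cases c <;> simp_all
  · exact h.apex_ne hab k
  · rw [← signedArea_rotate, ← signedArea_rotate]
    exact h.apex_ne (Ne.symm hac) j
  · exact h.spoke_ne a hbc
  · rw [← signedArea_rotate]
    exact h.apex_ne hbc i
  · rw [← signedArea_rotate]
    exact h.spoke_ne b (Ne.symm hac)
  · rw [← signedArea_rotate, ← signedArea_rotate]
    exact h.spoke_ne c hab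
  · exact h.path_ne i j k hab hac hbc

theorem inGeneralPosition (h : IsFanPlacement φ) : InGeneralPosition (Set.range φ) := by
  rintro _ ⟨a, rfl⟩ _ ⟨b, rfl⟩ _ ⟨c, rfl⟩ hab hac hbc
  rw [collinear_iff_signedArea_eq_zero]
  exact h.signedArea_ne (fun e => hab (e ▸ rfl)) (fun e => hac (e ▸ rfl)) (fun e => hbc (e ▸ rfl))

/-! #### The double fan is drawn without crossings -/

/-- The segments `ab` and `cd`, if different, meet in a common endpoint or not at all. -/
def SegmentsCompatible (φ : Bool ⊕ Fin n → Plane) (a b c d : Bool ⊕ Fin n) : Prop :=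
  s(a, b) ≠ s(c, d) → segment ℝ (φ a) (φ b) ∩ segment ℝ (φ c) (φ d) ⊆
    ({φ a, φ b} : Set Plane) ∩ {φ c, φ d}

theorem SegmentsCompatible.swap {a b c d : Bool ⊕ Fin n} (h : SegmentsCompatible φ a b c d) :
    SegmentsCompatible φ b a c d := by
  intro hne
  rw [segment_symm, Set.pair_comm]
  exact h (by rwa [Sym2.eq_swap])

theorem SegmentsCompatible.symm {a b c d : Bool ⊕ Fin n} (h : SegmentsCompatible φ a b c d) :
    SegmentsCompatible φ c d a b := by
  intro hne
  rw [Set.inter_comm, Set.inter_comm {φ c, φ d}]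
  exact h hne.symm

theorem SegmentsCompatible.of_forall_eq {a b c d : Bool ⊕ Fin n}
    (h : ∀ x, x ∈ segment ℝ (φ a) (φ b) → x ∈ segment ℝ (φ c) (φ d) →
      (x = φ a ∨ x = φ b) ∧ (x = φ c ∨ x = φ d)) : SegmentsCompatible φ a b c d :=
  fun _ x hx => h x hx.1 hx.2

/-- Segments with `c` and `d` on one side of the line `ab`, only `c` possibly on it. -/
theorem SegmentsCompatible.of_side {a b c d : Bool ⊕ Fin n} {k : ℝ}
    (hc : 0 < k * signedArea (φ a) (φ b) (φ c) ∨ c = a ∨ c = b)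
    (hd : 0 < k * signedArea (φ a) (φ b) (φ d)) : SegmentsCompatible φ a b c d := by
  refine .of_forall_eq fun x hx hx' => ?_
  have h0 := signedArea_eq_zero_of_mem_segment hx
  have hc' : 0 ≤ k * signedArea (φ a) (φ b) (φ c) := by
    rcases hc with hc | rfl | rfl
    · exact hc.le
    · simp
    · simp
  obtain rfl := eq_of_mem_segment_of_nonpos hx' hc' hd (by simp [h0])
  rcases hc with hc | rfl | rfl
  · simp [h0] at hc
  · simp
  · simp

theorem segmentsCompatible_apex_spoke (h : IsFanPlacement φ) (b : Bool) (i : Fin n) :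
    SegmentsCompatible φ (.inl true) (.inl false) (.inl b) (.inr i) :=
  .of_side (k := 1) (by cases b <;> simp) (by simpa [apexSign] using h.apex_pos true i)

theorem segmentsCompatible_apex_path (h : IsFanPlacement φ) (i j : Fin n) :
    SegmentsCompatible φ (.inl true) (.inl false) (.inr i) (.inr j) :=
  .of_side (k := 1) (.inl (by simpa [apexSign] using h.apex_pos true i))
    (by simpa [apexSign] using h.apex_pos true j)

/-- Spokes at one apex are separated by their angular order. For opposite apices, the line of the
spoke ending later on the path has the other apex and the earlier path point on one side. -/
theorem segmentsCompatible_spoke_spoke (h : IsFanPlacement φ) (b c : Bool) (i j : Fin n) :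
    SegmentsCompatible φ (.inl b) (.inr i) (.inl c) (.inr j) := by
  have neg : ∀ {x : ℝ}, apexSign b * x < 0 → 0 < -apexSign b * x := fun h => by linarith
  rcases eq_or_ne b c with rfl | hbc
  · rcases lt_trichotomy i j with hij | rfl | hij
    · exact .of_side (.inr (.inl rfl)) (h.spoke_pos b i j hij)
    · exact fun hne => absurd rfl hne
    · exact .of_side (k := -apexSign b) (.inr (.inl rfl)) (neg (h.spoke_neg b hij))
  · obtain rfl : c = !b := by cases b <;> cases c <;> simp_all
    rcases le_or_gt j i with hij | hij
    · refine SegmentsCompatible.symm (.swap (.symm (.of_side (k := -apexSign b) ?_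
        (neg (h.apex_neg b i)))))
      rcases hij.eq_or_lt with rfl | hij
      · exact .inr (.inr rfl)
      · exact .inl (neg (h.spoke_neg b hij))
    · refine .swap (.symm ?_)
      refine .of_side (k := -apexSign (!b)) (.inl ?_) ?_
      · linarith [h.spoke_neg (!b) hij]
      · have := h.apex_neg (!b) j
        rw [Bool.not_not] at this
        linarith

/-- No index lies strictly between `j` and `k`, so the path edge stays on one side of the spoke's
line. -/
theorem segmentsCompatible_spoke_path (h : IsFanPlacement φ) (b : Bool) (i j k : Fin n)
    (hjk : (j : ℕ) + 1 = k) : SegmentsCompatible φ (.inl b) (.inr i) (.inr j) (.inr k) := by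
  rcases le_or_gt i j with hij | hij
  · refine .of_side (k := apexSign b) ?_ (h.spoke_pos b i k (by omega))
    rcases hij.eq_or_lt with rfl | hij
    · exact .inr (.inr rfl)
    · exact .inl (h.spoke_pos b i j hij)
  · refine SegmentsCompatible.symm (.swap (.symm (.of_side (k := -apexSign b) ?_ ?_)))
    · rcases eq_or_ne k i with rfl | hki
      · exact .inr (.inr rfl)
      · exact .inl (by linarith [h.spoke_neg b (i := i) (j := k) (by omega)])
    · linarith [h.spoke_neg b hij]

/-- The line from an apex through `φ (.inr j)` separates the earlier edge from the later one,
touching the earlier only at that point. -/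
theorem segmentsCompatible_path_path_of_lt (h : IsFanPlacement φ) {i j k l : Fin n}
    (hij : (i : ℕ) + 1 = j) (hkl : (k : ℕ) + 1 = l) (hik : i < k) :
    SegmentsCompatible φ (.inr i) (.inr j) (.inr k) (.inr l) := by
  refine .of_forall_eq fun x hx hx' => ?_
  have hjk : j ≤ k := by omega
  have hk := h.spoke_nonneg true hjk
  have hl := h.spoke_pos true j l (by omega)
  have hi := h.spoke_neg true (i := j) (j := i) (by omega)
  have h1 := nonneg_of_mem_segment hx' hk hl.le
  have h2 : x = φ (.inr j) := by
    rw [segment_symm] at hx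
    refine eq_of_mem_segment_of_nonpos (k := -apexSign true) (a := φ (.inl true))
      (b := φ (.inr j)) hx (by simp) (by linarith) (by linarith)
  refine ⟨.inr h2, .inl ?_⟩
  exact eq_of_mem_segment_of_nonpos hx' hk hl (by simp [h2])

theorem segmentsCompatible_path_path (h : IsFanPlacement φ) {i j k l : Fin n}
    (hij : (i : ℕ) + 1 = j) (hkl : (k : ℕ) + 1 = l) :
    SegmentsCompatible φ (.inr i) (.inr j) (.inr k) (.inr l) := by
  rcases lt_trichotomy i k with hik | rfl | hik
  · exact h.segmentsCompatible_path_path_of_lt hij hkl hik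
  · obtain rfl : j = l := by omega
    exact fun hne => absurd rfl hne
  · exact (h.segmentsCompatible_path_path_of_lt hkl hij hik).symm

theorem segmentsCompatible_of_adj (h : IsFanPlacement φ) {a b c d : Bool ⊕ Fin n}
    (hab : (doubleFan n).Adj a b) (hcd : (doubleFan n).Adj c d) :
    SegmentsCompatible φ a b c d := by
  refine doubleFan_adj_induction (p := fun a b => SegmentsCompatible φ a b c d)
    (fun _ _ h => h.swap) ?_ (fun b i => ?_) (fun i j hij => ?_) hab
  · exact doubleFan_adj_induction (p := fun c d => SegmentsCompatible φ _ _ c d)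
      (fun _ _ h => h.symm.swap.symm) (fun hne => absurd rfl hne)
      h.segmentsCompatible_apex_spoke (fun i j _ => h.segmentsCompatible_apex_path i j) hcd
  · exact doubleFan_adj_induction (p := fun c d => SegmentsCompatible φ _ _ c d)
      (fun _ _ h => h.symm.swap.symm) (h.segmentsCompatible_apex_spoke b i).symm
      (fun c j => h.segmentsCompatible_spoke_spoke b c i j)
      (h.segmentsCompatible_spoke_path b i) hcd
  · exact doubleFan_adj_induction (p := fun c d => SegmentsCompatible φ _ _ c d)
      (fun _ _ h => h.symm.swap.symm) (h.segmentsCompatible_apex_path i j).symm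
      (fun b k => (h.segmentsCompatible_spoke_path b k i j hij).symm)
      (fun _ _ hkl => h.segmentsCompatible_path_path hij hkl) hcd

/-! #### The double fan is maximal -/

/-- The middle point lies strictly on one side of the chord; the spoke to it from the apex on the
other side crosses the chord. -/
theorem exists_spoke_crossing (h : IsFanPlacement φ) {i j k : Fin n} (hij : i < j) (hjk : j < k) :
    ∃ b, (segment ℝ (φ (.inr i)) (φ (.inr k)) ∩ segment ℝ (φ (.inl b)) (φ (.inr j))).Nonempty := by
  have hne := h.path_ne i k j (hij.trans hjk).ne hij.ne hjk.ne'
  obtain ⟨b, hb⟩ : ∃ b, apexSign b * signedArea (φ (.inr i)) (φ (.inr k)) (φ (.inr j)) < 0 := by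
    rcases lt_or_gt_of_ne hne with hlt | hgt
    · exact ⟨true, by simpa [apexSign] using hlt⟩
    · exact ⟨false, by simpa [apexSign] using hgt⟩
  refine ⟨b, exists_mem_segment_inter ?_ ?_⟩
  · have h1 := h.spoke_pos b i k (hij.trans hjk)
    rw [← signedArea_rotate] at h1
    have := mul_pos h1 (neg_pos.2 hb)
    cases b <;> simp only [apexSign] at this <;> simp at this ⊢ <;> linarith
  · have h1 := h.spoke_neg b hij
    have h2 := h.spoke_pos b j k hjk
    have := mul_pos (neg_pos.2 h1) h2
    cases b <;> simp only [apexSign] at this <;> simp at this ⊢ <;> linarith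

variable {A : Set Plane} {e : Bool ⊕ Fin n ≃ A}

theorem isTriangulation (h : IsFanPlacement fun a => (e a : Plane)) :
    IsTriangulation ((doubleFan n).comap e.symm) := by
  constructor
  · intro a b c d hab hcd hne
    have := h.segmentsCompatible_of_adj hab hcd
    simp only [SegmentsCompatible, Equiv.apply_symm_apply] at this
    apply this
    intro heq
    apply hne
    have := congrArg (Sym2.map e) heq
    simpa using this
  · intro G hG hle
    -- All pairs involving an apex are edges already, so only chords between path points can be new.
    have key : ∀ i k : Fin n, i < k → G.Adj (e (.inr i)) (e (.inr k)) → (i : ℕ) + 1 = k := by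
      intro i k hik hadj
      by_contra hne
      obtain ⟨j, hij, hjk⟩ : ∃ j : Fin n, i < j ∧ j < k :=
        ⟨⟨i + 1, by omega⟩, by simp [Fin.lt_def], by simp only [Fin.lt_def] at *; omega⟩
      obtain ⟨b, x, hx⟩ := h.exists_spoke_crossing hij hjk
      have hadj' : G.Adj (e (.inl b)) (e (.inr j)) :=
        hle (by simpa using doubleFan_adj_inl_inr b j)
      have hx' := hG _ _ _ _ hadj hadj' (by
        intro heq
        simp at heq) hx
      simp only [Set.mem_inter_iff, Set.mem_insert_iff, Set.mem_singleton_iff] at hx'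
      obtain ⟨rfl | rfl, hx' | hx'⟩ := hx' <;> have := h.injective hx' <;> simp at this
      · exact hij.ne this
      · exact hjk.ne' this
    intro a b hab
    obtain ⟨a, rfl⟩ := e.surjective a
    obtain ⟨b, rfl⟩ := e.surjective b
    simp only [SimpleGraph.comap_adj, Equiv.symm_apply_apply]
    rcases a with a | i <;> rcases b with b | j
    · rw [doubleFan_adj_inl_inl]
      rintro rfl
      exact hab.ne rfl
    · exact doubleFan_adj_inl_inr _ _
    · exact doubleFan_adj_inr_inl _ _
    · rw [doubleFan_adj_inr_inr]
      rcases lt_trichotomy i j with hij | rfl | hij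
      · exact .inl (key i j hij hab)
      · exact absurd rfl hab.ne
      · exact .inr (key j i hij hab.symm)

/-! #### The triangles of the double fan -/

/-- The wedge at the apex between consecutive spokes contains no other path point, and the other
apex lies outside it. -/
theorem empty_spoke_triangle (h : IsFanPlacement φ) (b : Bool) {i j : Fin n}
    (hij : (i : ℕ) + 1 = j) {a : Bool ⊕ Fin n}
    (ha : φ a ∈ convexHull ℝ ({φ (.inl b), φ (.inr i), φ (.inr j)} : Set Plane)) :
    a = .inl b ∨ a = .inr i ∨ a = .inr j := by
  have hlt : i < j := by omega
  have h1 := nonneg_of_mem_convexHull (a := φ (.inl b)) (b := φ (.inr i)) (k := apexSign b) ha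
    (by simpa using (h.spoke_pos b i j hlt).le)
  have h2 := nonneg_of_mem_convexHull (a := φ (.inl b)) (b := φ (.inr j)) (k := -apexSign b) ha
    (by simpa using (h.spoke_neg b hlt).le)
  rcases a with c | k
  · rcases eq_or_ne c b with rfl | hcb
    · exact .inl rfl
    · obtain rfl : c = !b := by cases b <;> cases c <;> simp_all
      linarith [h.apex_neg b i]
  · rcases lt_or_ge k i with hki | hki
    · linarith [h.spoke_neg b hki]
    rcases lt_or_ge j k with hjk | hjk
    · linarith [h.spoke_pos b j k hjk]
    simp only [reduceCtorEq, Sum.inr.injEq, false_or]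
    omega

/-- These triangles are nested along the path, so only the one at the first path point is empty,
although all have their three sides in the graph. -/
theorem mem_apex_triangle_iff (h : IsFanPlacement φ) (b : Bool) {i j : Fin n} :
    φ (.inr j) ∈ convexHull ℝ ({φ (.inl b), φ (.inl !b), φ (.inr i)} : Set Plane) ↔ j ≤ i := by
  constructor
  · intro hj
    have h1 := nonneg_of_mem_convexHull (a := φ (.inl b)) (b := φ (.inr i)) (k := -apexSign b) hj
      (by simpa using (h.apex_neg b i).le)
    by_contra! hij
    linarith [h.spoke_pos b i j hij]
  · intro hji
    have hs : apexSign (!b) = -apexSign b := by cases b <;> simp [apexSign]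
    refine mem_convexHull_of_signedArea (h.apex_pos b i) (h.apex_pos b j).le ?_ ?_
    · have := h.spoke_nonneg (!b) hji
      rw [hs, signedArea_swap] at this
      linarith
    · have := h.spoke_nonneg b hji
      rwa [← signedArea_rotate, ← signedArea_rotate] at this

theorem isClockwiseTriangle_apex_iff (h : IsFanPlacement fun a => (e a : Plane)) (b : Bool)
    (i : Fin n) : IsClockwiseTriangle ((doubleFan n).comap e.symm) (e (.inl b)) (e (.inl !b))
      (e (.inr i)) ↔ b = false ∧ ∀ j, i ≤ j := by
  have hpos := h.apex_pos b i
  constructor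
  · rintro ⟨-, -, -, hempty, hcw⟩
    constructor
    · cases b
      · rfl
      · change signedArea _ _ _ < 0 at hcw
        simp only [apexSign, if_true, one_mul] at hpos
        exact absurd hcw hpos.le.not_gt
    · intro j
      by_contra! hji
      have := hempty _ (e (.inr j)).2 ((h.mem_apex_triangle_iff b).2 hji.le)
      simp only [EmbeddingLike.apply_eq_iff_eq, Subtype.coe_inj, reduceCtorEq,
        Sum.inr.injEq, false_or] at this
      exact hji.ne this
  · rintro ⟨rfl, hi⟩
    refine ⟨by simp [doubleFan_adj_inl_inl], by simp [doubleFan_adj_inl_inr],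
      by simp [doubleFan_adj_inl_inr], ?_, ?_⟩
    · intro p hp hmem
      obtain ⟨a, ha⟩ := e.surjective ⟨p, hp⟩
      obtain rfl : (e a : Plane) = p := by rw [ha]
      rcases a with a | j
      · cases a <;> simp
      · have := (h.mem_apex_triangle_iff false).1 hmem
        rw [le_antisymm this (hi j)]
        simp
    · change signedArea _ _ _ < 0
      simp only [apexSign] at hpos
      simpa using hpos

theorem isClockwiseTriangle_spoke_iff (h : IsFanPlacement fun a => (e a : Plane)) (b : Bool)
    (i j : Fin n) : IsClockwiseTriangle ((doubleFan n).comap e.symm) (e (.inl b)) (e (.inr i))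
      (e (.inr j)) ↔ if b then (j : ℕ) + 1 = i else (i : ℕ) + 1 = j := by
  have hsign : ∀ i j : Fin n, i < j → if b then
      0 < signedArea (e (.inl b) : Plane) (e (.inr i)) (e (.inr j)) else
      signedArea (e (.inl b) : Plane) (e (.inr i)) (e (.inr j)) < 0 := by
    intro i j hij
    have := h.spoke_pos b i j hij
    cases b <;> simpa [apexSign] using this
  constructor
  · rintro ⟨-, hadj, -, -, hcw⟩
    change signedArea _ _ _ < 0 at hcw
    simp only [SimpleGraph.comap_adj, Equiv.symm_apply_apply, doubleFan_adj_inr_inr] at hadj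
    rcases hadj with hadj | hadj
    · have := hsign i j (by omega)
      cases b
      · simpa using hadj
      · exact absurd hcw (le_of_lt this).not_gt
    · have := hsign j i (by omega)
      rw [signedArea_swap] at this
      cases b
      · simp only [Bool.false_eq_true, if_false] at this
        linarith
      · simpa using hadj
  · intro hij
    have hadj : (i : ℕ) + 1 = j ∨ (j : ℕ) + 1 = i := by
      cases b
      · exact .inl hij
      · exact .inr hij
    refine ⟨by simp [doubleFan_adj_inl_inr], by simpa [doubleFan_adj_inr_inr] using hadj,
      by simp [doubleFan_adj_inl_inr], ?_, ?_⟩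
    · intro p hp hmem
      obtain ⟨a, ha⟩ := e.surjective ⟨p, hp⟩
      obtain rfl : (e a : Plane) = p := by rw [ha]
      have : a = .inl b ∨ a = .inr i ∨ a = .inr j := by
        rcases hadj with hadj | hadj
        · exact h.empty_spoke_triangle b hadj hmem
        · rw [Set.pair_comm] at hmem
          exact (h.empty_spoke_triangle b hadj hmem).imp_right Or.symm
      rcases this with rfl | rfl | rfl <;> simp
    · change signedArea _ _ _ < 0
      cases b
      · exact hsign i j (by simp at hij; omega)
      · have := hsign j i (by simp at hij; omega)
        rw [signedArea_swap] at this
        simpa using this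

end IsFanPlacement

/-! ### Compatibility of two fan placements -/

theorem IsClockwiseTriangle.rotate {A : Set Plane} {G : SimpleGraph A} {a b c : A}
    (h : IsClockwiseTriangle G a b c) : IsClockwiseTriangle G b c a := by
  obtain ⟨hab, hbc, hac, hempty, hcw⟩ := h
  refine ⟨hbc, hac.symm, hab.symm, ?_, ?_⟩
  · intro p hp hmem
    rw [Set.pair_comm, Set.insert_comm] at hmem
    have := hempty p hp hmem
    tauto
  · change signedArea _ _ _ < 0
    rw [signedArea_rotate]
    exact hcw

theorem isClockwiseTriangle_rotate_iff {A : Set Plane} {G : SimpleGraph A} {a b c : A} :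
    IsClockwiseTriangle G b c a ↔ IsClockwiseTriangle G a b c :=
  ⟨fun h => h.rotate.rotate, fun h => h.rotate⟩

theorem IsFanPlacement.areCompatible {n : ℕ} {A B : Set Plane} {e : Bool ⊕ Fin n ≃ A}
    {f : Bool ⊕ Fin n ≃ B} (he : IsFanPlacement fun a => (e a : Plane))
    (hf : IsFanPlacement fun a => (f a : Plane)) :
    AreCompatible ((doubleFan n).comap e.symm) ((doubleFan n).comap f.symm) := by
  refine ⟨e.symm.trans f, fun a b c => ?_⟩
  obtain ⟨a, rfl⟩ := e.surjective a
  obtain ⟨b, rfl⟩ := e.surjective b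
  obtain ⟨c, rfl⟩ := e.surjective c
  simp only [Equiv.trans_apply, Equiv.symm_apply_apply]
  have apex : ∀ (b c : Bool) (i : Fin n),
      IsClockwiseTriangle ((doubleFan n).comap e.symm) (e (.inl b)) (e (.inl c)) (e (.inr i)) ↔
      IsClockwiseTriangle ((doubleFan n).comap f.symm) (f (.inl b)) (f (.inl c)) (f (.inr i)) := by
    intro b c i
    rcases eq_or_ne b c with rfl | hbc
    · exact iff_of_false (fun h => h.1.ne rfl) (fun h => h.1.ne rfl)
    · obtain rfl : c = !b := by cases b <;> cases c <;> simp_all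
      rw [he.isClockwiseTriangle_apex_iff, hf.isClockwiseTriangle_apex_iff]
  have spoke : ∀ (b : Bool) (i j : Fin n),
      IsClockwiseTriangle ((doubleFan n).comap e.symm) (e (.inl b)) (e (.inr i)) (e (.inr j)) ↔
      IsClockwiseTriangle ((doubleFan n).comap f.symm) (f (.inl b)) (f (.inr i)) (f (.inr j)) := by
    intro b i j
    rw [he.isClockwiseTriangle_spoke_iff, hf.isClockwiseTriangle_spoke_iff]
  rcases a with a | i <;> rcases b with b | j <;> rcases c with c | k
  · refine iff_of_false (fun h => ?_) (fun h => ?_) <;>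
    · obtain ⟨h1, h2, h3, -, -⟩ := h
      simp only [SimpleGraph.comap_adj, Equiv.symm_apply_apply, doubleFan_adj_inl_inl] at h1 h2 h3
      cases a <;> cases b <;> cases c <;> simp_all
  · exact apex a b k
  · rw [← isClockwiseTriangle_rotate_iff, ← isClockwiseTriangle_rotate_iff, apex,
      isClockwiseTriangle_rotate_iff, isClockwiseTriangle_rotate_iff]
  · exact spoke a j k
  · rw [← isClockwiseTriangle_rotate_iff, apex, isClockwiseTriangle_rotate_iff]
  · rw [← isClockwiseTriangle_rotate_iff, spoke, isClockwiseTriangle_rotate_iff]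
  · rw [← isClockwiseTriangle_rotate_iff, ← isClockwiseTriangle_rotate_iff, spoke,
      isClockwiseTriangle_rotate_iff, isClockwiseTriangle_rotate_iff]
  · refine iff_of_false (fun h => ?_) (fun h => ?_) <;>
    · obtain ⟨h1, h2, h3, -, -⟩ := h
      simp only [SimpleGraph.comap_adj, Equiv.symm_apply_apply, doubleFan_adj_inr_inr] at h1 h2 h3
      -- Three integers cannot pairwise differ by one.
      omega

/-! ### Placing the two apices -/

/-- Each pair of distinct points rules out at most one `t`. -/
theorem exists_shear_injOn (S : Finset Plane) :
    ∃ t : ℝ, Set.InjOn (fun p : Plane => p 0 + t * p 1) S := by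
  have hfin : (⋃ p ∈ S, ⋃ q ∈ S, {t : ℝ | p ≠ q ∧ p 0 + t * p 1 = q 0 + t * q 1}).Finite := by
    refine S.finite_toSet.biUnion fun p _ => S.finite_toSet.biUnion fun q _ =>
      Set.Subsingleton.finite ?_
    rintro s ⟨hpq, hs⟩ t ⟨-, ht⟩
    have hmul : (s - t) * (p 1 - q 1) = 0 := by linarith
    rcases mul_eq_zero.1 hmul with h | h
    · exact sub_eq_zero.1 h
    · exfalso
      apply hpq
      have h1 : p 1 = q 1 := sub_eq_zero.1 h
      ext i; fin_cases i
      · simp only [h1] at hs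
        simpa using hs
      · exact h1
  obtain ⟨t, ht⟩ := hfin.infinite_compl.nonempty
  refine ⟨t, fun p hp q hq hpq => ?_⟩
  by_contra hne
  exact ht (Set.mem_biUnion hp (Set.mem_biUnion hq ⟨hne, hpq⟩))

theorem exists_strictMono_enumeration {n : ℕ} {S : Finset Plane} (hcard : S.card = n)
    {f : Plane → ℝ} (hf : Set.InjOn f S) :
    ∃ q : Fin n → Plane, Set.range q = S ∧ StrictMono (f ∘ q) := by
  have hcard' : (S.image f).card = n := by rw [Finset.card_image_of_injOn hf, hcard]
  have hex : ∀ i, ∃ p ∈ S, f p = (S.image f).orderEmbOfFin hcard' i := fun i =>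
    Finset.mem_image.1 (Finset.orderEmbOfFin_mem _ hcard' i)
  choose q hqS hq using hex
  refine ⟨q, Set.Subset.antisymm (Set.range_subset_iff.2 hqS) fun p hp => ?_, fun i j hij => ?_⟩
  · have hmem : f p ∈ Set.range ((S.image f).orderEmbOfFin hcard') := by
      rw [Finset.range_orderEmbOfFin]
      exact Finset.mem_coe.2 (Finset.mem_image_of_mem f hp)
    obtain ⟨i, hi⟩ := hmem
    exact ⟨i, hf (hqS i) hp ((hq i).trans hi)⟩
  · simpa [hq] using hij

/-- Two Steiner points extend every point set in general position to a placement of the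
double fan. -/
theorem exists_isFanPlacement {n : ℕ} {S : Finset Plane} (hcard : S.card = n)
    (hgen : InGeneralPosition (S : Set Plane)) :
    ∃ (P : Finset Plane) (φ : Bool ⊕ Fin n → Plane), Disjoint S P ∧ P.card ≤ 2 ∧
      IsFanPlacement φ ∧ Set.range φ = (S : Set Plane) ∪ (P : Set Plane) := by
  obtain ⟨t, ht⟩ := exists_shear_injOn S
  obtain ⟨q, hrange, hmono⟩ := exists_strictMono_enumeration hcard ht
  have hlt : ∀ i j, i < j → q i 0 + t * q i 1 < q j 0 + t * q j 1 := fun i j hij => hmono hij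
  obtain ⟨x, hx⟩ : ∃ x : ℝ, ∀ i, x < q i 0 + t * q i 1 := by
    obtain ⟨m, hm⟩ := (Set.finite_range fun i => q i 0 + t * q i 1).bddBelow
    exact ⟨m - 1, fun i => by linarith [hm (Set.mem_range_self i)]⟩
  -- `c` will be the midpoint of the apices. Moving from `c` to an apex changes the areas by `M`
  -- times the gap in the functional, up to sign, so for large `M` the sorted order decides every
  -- sign.
  let c : Plane := !₂[x, 0]
  have hev : ∀ᶠ M : ℝ in atTop, ∀ i j, i < j →
      |signedArea c (q i) (q j)| <
        M * ((q j 0 + t * q j 1) - (q i 0 + t * q i 1)) := by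
    refine eventually_all.2 fun i => eventually_all.2 fun j => ?_
    by_cases hij : i < j
    · have hpos := sub_pos.2 (hlt i j hij)
      filter_upwards [(tendsto_id.atTop_mul_const hpos).eventually_gt_atTop
        |signedArea c (q i) (q j)|] with M hM _
      exact hM
    · exact Eventually.of_forall fun _ h => absurd h hij
  obtain ⟨M, hM, hM0⟩ := (hev.and (eventually_gt_atTop 0)).exists
  -- The apices lie on the level line of value `x`, at heights `M` and `-M`.
  let w : Bool → Plane := fun b => !₂[x - apexSign b * M * t, apexSign b * M]
  have hsq : ∀ b, apexSign b * apexSign b = 1 := by intro b; cases b <;> simp [apexSign]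
  have hw : ∀ b, w b 0 + t * w b 1 = x := by intro b; simp [w]; ring
  have hwq : ∀ b i, w b ≠ q i := fun b i h => (hx i).ne (by rw [← h, hw])
  have hqinj : Function.Injective q := Function.Injective.of_comp hmono.injective
  refine ⟨Finset.univ.image w, Sum.elim w q, ?_, ?_, ⟨?_, ?_, ?_, ?_⟩, ?_⟩
  · rw [Finset.disjoint_left]
    intro p hp hpw
    obtain ⟨b, -, rfl⟩ := Finset.mem_image.1 hpw
    rw [← Finset.mem_coe, ← hrange] at hp
    obtain ⟨i, hi⟩ := hp
    exact hwq b i hi.symm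
  · exact Finset.card_image_le.trans (by simp)
  · refine Function.Injective.sumElim ?_ hqinj hwq
    intro b b' hbb
    have h1 : w b 1 = w b' 1 := by rw [hbb]
    cases b <;> cases b' <;> simp [w, apexSign] at h1 ⊢ <;> linarith
  · intro b i j hij
    simp only [Sum.elim_inl, Sum.elim_inr]
    have hcalc : apexSign b * signedArea (w b) (q i) (q j) = apexSign b * signedArea c (q i) (q j)
        + (apexSign b * apexSign b) * (M * ((q j 0 + t * q j 1) - (q i 0 + t * q i 1))) := by
      simp [signedArea, w, c]; ring
    rw [hcalc, hsq, one_mul]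
    have := abs_lt.1 (hM i j hij)
    cases b <;> simp [apexSign] <;> linarith
  · intro b i
    simp only [Sum.elim_inl, Sum.elim_inr]
    have hcalc : apexSign b * signedArea (w b) (w !b) (q i)
        = 2 * M * ((q i 0 + t * q i 1) - x) := by
      cases b <;> simp [signedArea, w, apexSign] <;> ring
    rw [hcalc]
    exact mul_pos (by linarith) (sub_pos.2 (hx i))
  · intro i j k hij hik hjk
    simp only [Sum.elim_inr]
    rw [ne_eq, ← collinear_iff_signedArea_eq_zero]
    have hmem : ∀ i, q i ∈ (S : Set Plane) := fun i => hrange ▸ Set.mem_range_self i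
    exact hgen _ (hmem i) _ (hmem j) _ (hmem k) (hqinj.ne hij) (hqinj.ne hik) (hqinj.ne hjk)
  · rw [Set.Sum.elim_range, hrange, Set.union_comm, Finset.coe_image, Finset.coe_univ, Set.image_univ]

/-! ### The main theorem -/

theorem theorem15 (d n : ℕ) (S : Fin d → Finset Plane)
    (hcard : ∀ i, (S i).card = n)
    (hgen : ∀ i, InGeneralPosition (S i : Set Plane)) :
    ∃ (P : Fin d → Finset Plane)
      (T : ∀ i, SimpleGraph ((S i : Set Plane) ∪ (P i : Set Plane) : Set Plane)),
      (∀ i, Disjoint (S i) (P i)) ∧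
      (∀ i, ((P i).card : ℝ) ≤ (n : ℝ) / 2 + 3) ∧
      (∀ i, InGeneralPosition ((S i : Set Plane) ∪ (P i : Set Plane))) ∧
      (∀ i, IsTriangulation (T i)) ∧
      (∀ i j, AreCompatible (T i) (T j)) := by
  choose P φ hdisj hP hφ hrange using fun i => exists_isFanPlacement (hcard i) (hgen i)
  -- All the sets are labelled by the same vertices, so the same graph is transported to each.
  let e : ∀ i, Bool ⊕ Fin n ≃ ((S i : Set Plane) ∪ (P i : Set Plane) : Set Plane) := fun i =>
    (Equiv.ofInjective (φ i) (hφ i).injective).trans (Equiv.setCongr (hrange i))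
  have he : ∀ i, IsFanPlacement fun a => (e i a : Plane) := hφ
  refine ⟨P, fun i => (doubleFan n).comap (e i).symm, hdisj, fun i => ?_, fun i => ?_,
    fun i => (he i).isTriangulation, fun i j => (he i).areCompatible (he j)⟩
  · have h2 : ((P i).card : ℝ) ≤ 2 := by exact_mod_cast hP i
    have hn : (0 : ℝ) ≤ n := n.cast_nonneg
    linarith
  · rw [← hrange i]
    exact (hφ i).inGeneralPosition
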